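/- Let $\mathbb{K}=\mathbb{F}_s$ be a finite field with $s$ elements, let $N\ge 1$, let $q$ be a $\mathbb{K}$-point of $\mathbf{P}^N(\mathbb{K})$, and let $I\subseteq \mathbb{K}[x_0,\dots,x_N]$ be the ideal generated by all homogeneous polynomials that vanish at every point of $\mathbf{P}^N(\mathbb{K})\setminus\{q\}$. Then the Castelnuovo–Mumford regularity of $I$ is $\operatorname{reg}(I)=N(s-1)+1$. Here $\operatorname{reg}(I)$ is the maximum of $a-i$ over all $i\ge 0$ and all degrees $a$ of elements of a homogeneous basis of $F_i$, where $\cdots\to F_1\to F_0\to I\to 0$ is a minimal graded free resolution of $I$ over $\mathbb{K}[x_0,\dots,x_N]$. -/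

import Mathlib

/-- The ideal of a set `S` of `K`-points of the projective space `P^N(K)`: the ideal of
`K[x_0, …, x_N]` generated by all homogeneous polynomials that vanish on `S`. -/
noncomputable def pointsIdeal {K : Type*} [Field K] {N : ℕ}
    (S : Set (Projectivization K (Fin (N + 1) → K))) :
    Ideal (MvPolynomial (Fin (N + 1)) K) :=
  Ideal.span {f | (∃ d : ℕ, f.IsHomogeneous d) ∧
    ∀ (v : Fin (N + 1) → K) (hv : v ≠ 0),
      Projectivization.mk K v hv ∈ S → MvPolynomial.eval v f = 0}

/-- `f` is homogeneous of degree `e - a`, i.e. an element of degree `e` of the twist `R(-a)` of the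
standard graded polynomial ring `R` (the only such element is `0` if `e < a`). -/
def IsTwistHomogeneous {K : Type*} [Field K] {σ : Type*} (a e : ℤ) (f : MvPolynomial σ K) : Prop :=
  f = 0 ∨ ∃ k : ℕ, e = a + k ∧ f.IsHomogeneous k

/-- A minimal graded free resolution
`⋯ ⟶ F_2 ⟶ F_1 ⟶ F_0 ⟶ I ⟶ 0` of an ideal `I` of the standard graded polynomial ring
`R = K[x_0, …, x_N]`, where `F_i = ⨁_b R(-shift i b)` is a graded free module of finite rank. -/
structure MinimalGradedFreeResolution {K : Type*} [Field K] {N : ℕ}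
    (I : Ideal (MvPolynomial (Fin (N + 1)) K)) where
  /-- the rank of `F_i` -/
  rank : ℕ → ℕ
  /-- the degrees of the basis elements of `F_i` -/
  shift : (i : ℕ) → Fin (rank i) → ℤ
  /-- the augmentation `F_0 ⟶ R`, with image `I` -/
  aug : (Fin (rank 0) → MvPolynomial (Fin (N + 1)) K) →ₗ[MvPolynomial (Fin (N + 1)) K]
    MvPolynomial (Fin (N + 1)) K
  /-- the differential `F_{i+1} ⟶ F_i` -/
  diff : (i : ℕ) →
    (Fin (rank (i + 1)) → MvPolynomial (Fin (N + 1)) K) →ₗ[MvPolynomial (Fin (N + 1)) K]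
      (Fin (rank i) → MvPolynomial (Fin (N + 1)) K)
  /-- the augmentation is homogeneous of degree `0` -/
  aug_homogeneous : ∀ b : Fin (rank 0),
    IsTwistHomogeneous 0 (shift 0 b) (aug (Pi.single b 1))
  /-- the differentials are homogeneous of degree `0` -/
  diff_homogeneous : ∀ (i : ℕ) (b : Fin (rank (i + 1))) (c : Fin (rank i)),
    IsTwistHomogeneous (shift i c) (shift (i + 1) b) (diff i (Pi.single b 1) c)
  range_aug : LinearMap.range aug = I
  exact_zero : LinearMap.range (diff 0) = LinearMap.ker aug
  exact_succ : ∀ i : ℕ, LinearMap.range (diff (i + 1)) = LinearMap.ker (diff i)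
  /-- minimality: the image of `F_{i+1}` lies in `m F_i`, with `m = (x_0, …, x_N)` -/
  minimal : ∀ (i : ℕ) (v : Fin (rank (i + 1)) → MvPolynomial (Fin (N + 1)) K)
    (c : Fin (rank i)), MvPolynomial.constantCoeff (diff i v c) = 0

/-- `reg I = r`: the Castelnuovo–Mumford regularity of the ideal `I`, i.e. the maximum of `a - i`
over all homological degrees `i` and all degrees `a` of basis elements of `F_i` in a minimal
graded free resolution `F` of `I` (such an `F` is unique up to isomorphism). -/
def HasRegularity {K : Type*} [Field K] {N : ℕ}
    (I : Ideal (MvPolynomial (Fin (N + 1)) K)) (r : ℤ) : Prop :=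
  IsGreatest {t : ℤ | ∃ (F : MinimalGradedFreeResolution I) (i : ℕ) (b : Fin (F.rank i)),
    t = F.shift i b - i} r

/-! Write `R` for the polynomial ring, `s` for the size of `K`, and `e = N (s - 1)`. Upper bound: in
every degree `≥ e` the forms realise all functions on the points other than `q` (`exists_separator`,
`exists_interpolation`). A form `y` of degree `e` with value `1` at those points is a nonzerodivisor
on `R / I`. A form `f` of degree `k ≥ 2e` agrees on the points with `y g`, where `g` of degree `k -
e` interpolates `f`; hence `R / (I, y)` vanishes in degrees `> 2e - 1`. The mapping cone of `y` is a
minimal resolution of this quotient. For a module vanishing in degrees `> D`, basis elements in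
homological degree `j > 0` have degree at most `D + j`: reduce the resolution modulo one variable at
a time (`exists_homogeneous_preimage_mod_variableIdeal`). A basis element of `F_i` reappears in the
cone in homological degree `i + 2`, with degree raised by `e`, so its degree is at most `e + i + 1`.
Lower bound: forms in `I` of degree `≤ e` vanish at `q`, by summing over all of `K^(N+1)` as in
Chevalley–Warning, while some form in `I` of degree `e + 1` does not. Hence `F_0` has a basis
element of degree at least `e + 1`. Attaining the maximum also requires that a minimal resolution
exists; it is built from iterated minimal covers. -/

/-! ### Homogeneous polynomials with integer twists -/

section GradedPolynomials

variable {K : Type*} [Field K] {σ : Type*}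

/-- In this form zero and negative degrees need no separate case, which simplifies the closure
lemmas. -/
theorem isTwistHomogeneous_iff {a e : ℤ} {f : MvPolynomial σ K} :
    IsTwistHomogeneous a e f ↔ ∀ m, f.coeff m ≠ 0 → (m.degree : ℤ) = e - a := by
  constructor
  · rintro (rfl | ⟨k, hk, hf⟩) m hm
    · simp at hm
    · have : m.degree = k := by
        by_contra h
        exact hm (hf.coeff_eq_zero h)
      omega
  · intro h
    by_cases hf : f = 0
    · exact Or.inl hf
    · obtain ⟨m, hm⟩ := MvPolynomial.ne_zero_iff.1 hf
      have h0 := h m hm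
      refine Or.inr ⟨m.degree, by omega, fun n hn => ?_⟩
      have h1 := h n hn
      have h2 : Finsupp.weight (1 : σ → ℕ) n = n.degree := by
        rw [Finsupp.degree_eq_weight_one]
        rfl
      rw [h2]
      omega

theorem IsTwistHomogeneous.zero (a e : ℤ) : IsTwistHomogeneous a e (0 : MvPolynomial σ K) :=
  Or.inl rfl

theorem IsTwistHomogeneous.add {a e : ℤ} {f g : MvPolynomial σ K}
    (hf : IsTwistHomogeneous a e f) (hg : IsTwistHomogeneous a e g) :
    IsTwistHomogeneous a e (f + g) := by
  rw [isTwistHomogeneous_iff] at *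
  intro m hm
  rw [MvPolynomial.coeff_add] at hm
  by_cases h : f.coeff m = 0
  · exact hg m fun h' => hm (by rw [h, h', add_zero])
  · exact hf m h

theorem IsTwistHomogeneous.neg {a e : ℤ} {f : MvPolynomial σ K}
    (hf : IsTwistHomogeneous a e f) : IsTwistHomogeneous a e (-f) := by
  rw [isTwistHomogeneous_iff] at *
  intro m hm
  exact hf m (by simpa using hm)

theorem IsTwistHomogeneous.sub {a e : ℤ} {f g : MvPolynomial σ K}
    (hf : IsTwistHomogeneous a e f) (hg : IsTwistHomogeneous a e g) :
    IsTwistHomogeneous a e (f - g) := by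
  rw [sub_eq_add_neg]
  exact hf.add hg.neg

theorem IsTwistHomogeneous.mul {a b e : ℤ} {f g : MvPolynomial σ K}
    (hf : IsTwistHomogeneous b e f) (hg : IsTwistHomogeneous a b g) :
    IsTwistHomogeneous a e (f * g) := by
  rcases hf with rfl | ⟨k, hk, hf⟩
  · left; simp
  rcases hg with rfl | ⟨l, hl, hg⟩
  · left; simp
  exact Or.inr ⟨k + l, by push_cast; omega, hf.mul hg⟩

theorem IsTwistHomogeneous.shift {a b e e' : ℤ} {f : MvPolynomial σ K}
    (hf : IsTwistHomogeneous a e f) (h : e - a = e' - b) : IsTwistHomogeneous b e' f := by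
  rw [isTwistHomogeneous_iff] at *
  intro m hm
  rw [hf m hm, h]

theorem MvPolynomial.IsHomogeneous.isTwistHomogeneous {a e : ℤ} {k : ℕ} {f : MvPolynomial σ K}
    (hf : f.IsHomogeneous k) (h : e = a + k) : IsTwistHomogeneous a e f :=
  Or.inr ⟨k, h, hf⟩

theorem isTwistHomogeneous_one (a : ℤ) : IsTwistHomogeneous a a (1 : MvPolynomial σ K) :=
  (MvPolynomial.isHomogeneous_one σ K).isTwistHomogeneous (by simp)

/-- The homogeneous component of integral degree `n`, which is zero for `n < 0`. -/
noncomputable def twistComponent (n : ℤ) : MvPolynomial σ K →ₗ[K] MvPolynomial σ K :=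
  if 0 ≤ n then MvPolynomial.homogeneousComponent n.toNat else 0

open Classical in
theorem coeff_twistComponent (n : ℤ) (f : MvPolynomial σ K) (m : σ →₀ ℕ) :
    (twistComponent n f).coeff m = if (m.degree : ℤ) = n then f.coeff m else 0 := by
  unfold twistComponent
  split_ifs with h1 h2 h2
  · rw [MvPolynomial.coeff_homogeneousComponent, if_pos (by omega)]
  · rw [MvPolynomial.coeff_homogeneousComponent, if_neg (by omega)]
  · omega
  · simp

theorem isTwistHomogeneous_twistComponent {a e n : ℤ} (h : n = e - a) (f : MvPolynomial σ K) :
    IsTwistHomogeneous a e (twistComponent n f) := by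
  classical
  rw [isTwistHomogeneous_iff]
  intro m hm
  rw [coeff_twistComponent] at hm
  by_contra h'
  exact hm (if_neg (by omega))

theorem IsTwistHomogeneous.twistComponent_eq {a e n : ℤ} {f : MvPolynomial σ K}
    (hf : IsTwistHomogeneous a e f) (h : n = e - a) : twistComponent n f = f := by
  classical
  rw [isTwistHomogeneous_iff] at hf
  ext m
  rw [coeff_twistComponent]
  split_ifs with hm
  · rfl
  · by_contra h'
    exact hm (by rw [hf m (Ne.symm h'), h])

/-- In the product only monomials of `g` of degree `b - a` contribute, so the degree of the monomial
taken from `f` is forced. -/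
theorem twistComponent_mul {a b n n' : ℤ} {g : MvPolynomial σ K} (hg : IsTwistHomogeneous a b g)
    (f : MvPolynomial σ K) (h : n' = n + (b - a)) :
    twistComponent n' (f * g) = twistComponent n f * g := by
  classical
  rw [isTwistHomogeneous_iff] at hg
  ext m
  rw [coeff_twistComponent, MvPolynomial.coeff_mul, MvPolynomial.coeff_mul]
  have key : ∀ x ∈ Finset.HasAntidiagonal.antidiagonal m,
      (twistComponent n f).coeff x.1 * g.coeff x.2 =
      if (m.degree : ℤ) = n' then f.coeff x.1 * g.coeff x.2 else 0 := by
    intro x hx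
    by_cases h2 : g.coeff x.2 = 0
    · simp [h2]
    · have h3 := hg _ h2
      rw [Finset.HasAntidiagonal.mem_antidiagonal] at hx
      have h4 : m.degree = x.1.degree + x.2.degree := by rw [← hx, map_add]
      rw [coeff_twistComponent, ite_mul, zero_mul]
      exact if_congr (by omega) rfl rfl
  rw [Finset.sum_congr rfl key]
  split_ifs <;> simp

theorem constantCoeff_twistComponent_zero (f : MvPolynomial σ K) :
    twistComponent 0 f = MvPolynomial.C (MvPolynomial.constantCoeff f) := by
  simp [twistComponent, MvPolynomial.constantCoeff_eq]

end GradedPolynomials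

/-! ### Graded free modules and their homogeneous maps -/

section GradedFreeModules

open MvPolynomial

variable {K : Type*} [Field K] {σ : Type*} {ι κ : Type*}

/-- The vector `v` is homogeneous of degree `e` in the graded free module `⨁_c R(-s c)`. -/
def IsHomogeneousVector (s : ι → ℤ) (e : ℤ) (v : ι → MvPolynomial σ K) : Prop :=
  ∀ c, IsTwistHomogeneous (s c) e (v c)

/-- A linear map of graded free modules which is homogeneous of degree `0`. -/
def IsHomogeneousMap [DecidableEq ι] (s : ι → ℤ) (t : κ → ℤ)
    (φ : (ι → MvPolynomial σ K) →ₗ[MvPolynomial σ K] (κ → MvPolynomial σ K)) : Prop :=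
  ∀ b, IsHomogeneousVector t (s b) (φ (Pi.single b 1))

/-- The component of degree `e` of a vector of the graded free module `⨁_c R(-s c)`. -/
noncomputable def gradedPart (s : ι → ℤ) (e : ℤ) (v : ι → MvPolynomial σ K) :
    ι → MvPolynomial σ K :=
  fun c => twistComponent (e - s c) (v c)

theorem isHomogeneousVector_gradedPart (s : ι → ℤ) (e : ℤ) (v : ι → MvPolynomial σ K) :
    IsHomogeneousVector s e (gradedPart s e v) :=
  fun _ => isTwistHomogeneous_twistComponent rfl _

theorem IsHomogeneousVector.gradedPart_eq {s : ι → ℤ} {e : ℤ} {v : ι → MvPolynomial σ K}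
    (h : IsHomogeneousVector s e v) : gradedPart s e v = v :=
  funext fun c => (h c).twistComponent_eq rfl

theorem isHomogeneousVector_single [DecidableEq ι] (s : ι → ℤ) (b : ι) :
    IsHomogeneousVector s (s b) (Pi.single b (1 : MvPolynomial σ K)) := by
  intro c
  by_cases h : c = b
  · subst h
    simpa using isTwistHomogeneous_one (s c)
  · rw [Pi.single_eq_of_ne h]
    exact IsTwistHomogeneous.zero _ _

theorem IsHomogeneousVector.sub {s : ι → ℤ} {e : ℤ} {v w : ι → MvPolynomial σ K}
    (hv : IsHomogeneousVector s e v) (hw : IsHomogeneousVector s e w) :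
    IsHomogeneousVector s e (v - w) := fun c => (hv c).sub (hw c)

theorem linearMap_apply_eq_sum [Fintype ι] [DecidableEq ι] {R : Type*} [CommSemiring R]
    (φ : (ι → R) →ₗ[R] (κ → R)) (v : ι → R) (c : κ) :
    φ v c = ∑ b, v b * φ (Pi.single b 1) c := by
  conv_lhs => rw [pi_eq_sum_univ' v]
  simp [map_sum, Finset.sum_apply]

theorem gradedPart_map [Fintype ι] [DecidableEq ι] {s : ι → ℤ} {t : κ → ℤ}
    {φ : (ι → MvPolynomial σ K) →ₗ[MvPolynomial σ K] (κ → MvPolynomial σ K)}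
    (hφ : IsHomogeneousMap s t φ) (e : ℤ) (v : ι → MvPolynomial σ K) :
    gradedPart t e (φ v) = φ (gradedPart s e v) := by
  ext1 c
  rw [gradedPart, linearMap_apply_eq_sum, linearMap_apply_eq_sum, map_sum]
  refine Finset.sum_congr rfl fun b _ => ?_
  exact twistComponent_mul (hφ b c) _ (by ring)

theorem IsHomogeneousMap.map [Fintype ι] [DecidableEq ι] {s : ι → ℤ} {t : κ → ℤ}
    {φ : (ι → MvPolynomial σ K) →ₗ[MvPolynomial σ K] (κ → MvPolynomial σ K)}
    (hφ : IsHomogeneousMap s t φ) {e : ℤ} {v : ι → MvPolynomial σ K}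
    (hv : IsHomogeneousVector s e v) : IsHomogeneousVector t e (φ v) := by
  rw [← hv.gradedPart_eq, ← gradedPart_map hφ]
  exact isHomogeneousVector_gradedPart _ _ _

theorem exists_sum_gradedPart [Fintype ι] (s : ι → ℤ) (v : ι → MvPolynomial σ K) :
    ∃ T : Finset ℤ, v = ∑ e ∈ T, gradedPart s e v := by
  classical
  refine ⟨Finset.univ.biUnion fun c => (v c).support.image fun m => (m.degree : ℤ) + s c, ?_⟩
  ext c m
  rw [Finset.sum_apply, coeff_sum]
  simp only [gradedPart, coeff_twistComponent]
  by_cases hm : (v c).coeff m = 0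
  · simp [hm]
  · rw [Finset.sum_eq_single ((m.degree : ℤ) + s c)]
    · simp
    · intro b _ hb
      exact if_neg (by omega)
    · intro h
      exact absurd (Finset.mem_biUnion.2 ⟨c, Finset.mem_univ c,
        Finset.mem_image.2 ⟨m, mem_support_iff.2 hm, rfl⟩⟩) h

end GradedFreeModules

/-! ### Ideals generated by initial variables -/

section VariableIdeals

open MvPolynomial

variable {K : Type*} [Field K] {n : ℕ}

/-- The ideal generated by the first `k` variables. -/
noncomputable def variableIdeal (K : Type*) [Field K] (n k : ℕ) : Ideal (MvPolynomial (Fin n) K) :=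
  Ideal.span (X '' {i : Fin n | (i : ℕ) < k})

theorem mem_variableIdeal {k : ℕ} {f : MvPolynomial (Fin n) K} :
    f ∈ variableIdeal K n k ↔ ∀ m, f.coeff m ≠ 0 → ∃ i : Fin n, (i : ℕ) < k ∧ m i ≠ 0 := by
  rw [variableIdeal, mem_ideal_span_X_image]
  simp [mem_support_iff]

theorem variableIdeal_mono {k l : ℕ} (h : k ≤ l) : variableIdeal K n k ≤ variableIdeal K n l :=
  Ideal.span_mono (Set.image_mono fun _ hi => lt_of_lt_of_le hi h)

theorem mem_variableIdeal_zero {f : MvPolynomial (Fin n) K} :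
    f ∈ variableIdeal K n 0 ↔ f = 0 := by
  simp [variableIdeal]

theorem mem_variableIdeal_self {f : MvPolynomial (Fin n) K} :
    f ∈ variableIdeal K n n ↔ constantCoeff f = 0 := by
  rw [mem_variableIdeal, constantCoeff_eq]
  constructor
  · intro h
    by_contra h0
    obtain ⟨i, -, hi⟩ := h 0 h0
    exact hi rfl
  · intro h m hm
    by_contra! h'
    exact hm (by rwa [show m = 0 from Finsupp.ext fun i => h' i i.2])

/-- The remainder consists of the monomials free of `x_k`, and each of these must contain an earlier
variable. -/
theorem sub_X_mul_divMonomial_mem {k : ℕ} (hk : k < n) {f : MvPolynomial (Fin n) K}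
    (hf : f ∈ variableIdeal K n (k + 1)) :
    f - X ⟨k, hk⟩ * divMonomial f (Finsupp.single ⟨k, hk⟩ 1) ∈ variableIdeal K n k := by
  have h1 : f - X ⟨k, hk⟩ * divMonomial f (Finsupp.single ⟨k, hk⟩ 1) =
      modMonomial f (Finsupp.single ⟨k, hk⟩ 1) := by
    rw [sub_eq_iff_eq_add, add_comm]
    exact (divMonomial_add_modMonomial_single f _).symm
  rw [h1]
  rw [mem_variableIdeal] at *
  intro m hm
  by_cases hle : Finsupp.single ⟨k, hk⟩ 1 ≤ m
  · exact absurd (coeff_modMonomial_of_le _ hle) hm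
  · rw [coeff_modMonomial_of_not_le _ hle] at hm
    obtain ⟨i, hi, hmi⟩ := hf m hm
    refine ⟨i, ?_, hmi⟩
    by_contra hik
    obtain rfl : i = ⟨k, hk⟩ := Fin.ext (by simp; omega)
    exact hle (by rw [Finsupp.single_le_iff]; omega)

/-- The variables form a regular sequence: multiplying by `x_k` does not change the exponents of
earlier variables. -/
theorem mem_of_X_mul_mem {k : ℕ} (hk : k < n) {f : MvPolynomial (Fin n) K}
    (hf : X ⟨k, hk⟩ * f ∈ variableIdeal K n k) : f ∈ variableIdeal K n k := by
  rw [mem_variableIdeal] at *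
  intro m hm
  obtain ⟨i, hi, hmi⟩ := hf (Finsupp.single ⟨k, hk⟩ 1 + m) (by rwa [coeff_X_mul])
  refine ⟨i, hi, ?_⟩
  have : (⟨k, hk⟩ : Fin n) ≠ i := fun h => by rw [← h] at hi; simp at hi
  simpa [Finsupp.single_apply, this] using hmi

theorem IsTwistHomogeneous.divMonomial_X {a e : ℤ} {f : MvPolynomial (Fin n) K}
    (hf : IsTwistHomogeneous a e f) (i : Fin n) :
    IsTwistHomogeneous a (e - 1) (divMonomial f (Finsupp.single i 1)) := by
  rw [isTwistHomogeneous_iff] at *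
  intro m hm
  rw [coeff_divMonomial] at hm
  have := hf _ hm
  rw [map_add, Finsupp.degree_single] at this
  push_cast at this
  omega

end VariableIdeals

/-! ### Degree bounds from the vanishing of `H_0` -/

section AcyclicComplexes

open MvPolynomial

/-- Any preimage may be replaced by its component of degree `e`. -/
theorem IsHomogeneousMap.exists_preimage {K : Type*} [Field K] {σ ι κ : Type*} [Fintype ι]
    [DecidableEq ι] {s : ι → ℤ} {t : κ → ℤ}
    {φ : (ι → MvPolynomial σ K) →ₗ[MvPolynomial σ K] (κ → MvPolynomial σ K)}
    (hφ : IsHomogeneousMap s t φ) {e : ℤ} {v : κ → MvPolynomial σ K}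
    (hv : IsHomogeneousVector t e v) (h : v ∈ LinearMap.range φ) :
    ∃ u, IsHomogeneousVector s e u ∧ φ u = v := by
  obtain ⟨u, rfl⟩ := h
  exact ⟨gradedPart s e u, isHomogeneousVector_gradedPart _ _ _, by
    rw [← gradedPart_map hφ, hv.gradedPart_eq]⟩

variable {K : Type*} [Field K] {n : ℕ} {ι : ℕ → Type*} [∀ i, Fintype (ι i)]
  [∀ i, DecidableEq (ι i)] {s : ∀ i, ι i → ℤ}
  {d : ∀ i, (ι (i + 1) → MvPolynomial (Fin n) K) →ₗ[MvPolynomial (Fin n) K]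
    (ι i → MvPolynomial (Fin n) K)}

/-- If `H_0` of a graded free resolution vanishes in degrees `> D`, then `H_{i+1}` of its
reduction modulo the first `k` variables vanishes in degrees `> D + i + 1`. -/
theorem exists_homogeneous_preimage_mod_variableIdeal
    (hd : ∀ i, IsHomogeneousMap (s (i + 1)) (s i) (d i))
    (hex : ∀ i, LinearMap.range (d (i + 1)) = LinearMap.ker (d i)) {D : ℤ}
    (hD : ∀ e, D < e → ∀ v, IsHomogeneousVector (s 0) e v → v ∈ LinearMap.range (d 0))
    {k : ℕ} (hk : k ≤ n) (i : ℕ) {e : ℤ} (he : D + i + 1 < e)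
    {v : ι (i + 1) → MvPolynomial (Fin n) K}
    (hv : IsHomogeneousVector (s (i + 1)) e v) (hdv : ∀ c, d i v c ∈ variableIdeal K n k) :
    ∃ u, IsHomogeneousVector (s (i + 2)) e u ∧
      ∀ c, (v - d (i + 1) u) c ∈ variableIdeal K n k := by
  induction k generalizing i e with
  | zero =>
    have h0 : d i v = 0 := funext fun c => mem_variableIdeal_zero.1 (hdv c)
    obtain ⟨u, hu, rfl⟩ := (hd (i + 1)).exists_preimage hv (by rw [hex]; exact h0)
    exact ⟨u, hu, fun c => by simp⟩
  | succ k ih =>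
    have hkn : k < n := hk
    have hJ : variableIdeal K n k ≤ variableIdeal K n (k + 1) := variableIdeal_mono k.le_succ
    set x : MvPolynomial (Fin n) K := X ⟨k, hkn⟩ with hx
    -- Modulo the first `k` variables, `d v = x w`: the class of `w` is the image of `v` under the
    -- connecting map of the sequence for multiplication by `x`, whence the degree `e - 1`.
    set w : ι i → MvPolynomial (Fin n) K :=
      fun c => divMonomial (d i v c) (Finsupp.single ⟨k, hkn⟩ 1) with hw
    have hwh : IsHomogeneousVector (s i) (e - 1) w := fun c =>
      ((hd i).map hv c).divMonomial_X _
    have hdw : ∀ c, (d i v - x • w) c ∈ variableIdeal K n k := fun c =>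
      sub_X_mul_divMonomial_mem hkn (hdv c)
    have hu : ∃ u, IsHomogeneousVector (s (i + 1)) (e - 1) u ∧
        ∀ c, (w - d i u) c ∈ variableIdeal K n k := by
      -- For `i = 0` every `w` of this degree is a boundary by `hD`; otherwise `w` is a cycle modulo
      -- `k` variables because `x` can be cancelled, and induction applies.
      cases i with
      | zero =>
        obtain ⟨u, hu, hu'⟩ := (hd 0).exists_preimage hwh
          (hD (e - 1) (by push_cast at he; omega) w hwh)
        exact ⟨u, hu, fun c => by simp [hu']⟩
      | succ i =>
        refine ih hkn.le i (by push_cast at he; omega) hwh fun c => mem_of_X_mul_mem hkn ?_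
        have h1 := Ideal.map_pi _ _ hdw (d i) c
        have h2 : d i (d (i + 1) v) = 0 :=
          LinearMap.mem_ker.1 ((hex i).le (LinearMap.mem_range_self _ v))
        rw [map_sub, h2, map_smul, zero_sub, Pi.neg_apply, neg_mem_iff, Pi.smul_apply,
          smul_eq_mul] at h1
        exact h1
    obtain ⟨u, hu, huw⟩ := hu
    have hxu : IsHomogeneousVector (s (i + 1)) e (x • u) := fun c =>
      ((isHomogeneous_X K _).isTwistHomogeneous (by simp : e = (e - 1) + (1 : ℕ))).mul (hu c)
    -- Since `w` is a boundary, `v - x u` is a cycle modulo only `k` variables.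
    obtain ⟨u', hu', h⟩ := ih hkn.le i he (hv.sub hxu) (by
      intro c
      have h1 : d i (v - x • u) = (d i v - x • w) + x • (w - d i u) := by
        rw [map_sub, map_smul, smul_sub]
        abel
      rw [h1]
      exact Ideal.add_mem _ (hdw c) (Ideal.mul_mem_left _ _ (huw c)))
    refine ⟨u', hu', fun c => ?_⟩
    have h1 : v - d (i + 1) u' = (v - x • u - d (i + 1) u') + x • u := by abel
    rw [h1]
    exact Ideal.add_mem _ (hJ (h c)) (Ideal.mul_mem_right _ _
      (Ideal.subset_span ⟨⟨k, hkn⟩, by simp, rfl⟩))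

/-- If `H_0` of a minimal graded free resolution vanishes in degrees `> D`, then the basis elements
in homological degree `i + 1` have degree at most `D + i + 1`. -/
theorem degree_le_of_minimal
    (hd : ∀ i, IsHomogeneousMap (s (i + 1)) (s i) (d i))
    (hex : ∀ i, LinearMap.range (d (i + 1)) = LinearMap.ker (d i)) {D : ℤ}
    (hD : ∀ e, D < e → ∀ v, IsHomogeneousVector (s 0) e v → v ∈ LinearMap.range (d 0))
    (hmin : ∀ i v c, constantCoeff (d i v c) = 0) (i : ℕ) (b : ι (i + 1)) :
    s (i + 1) b ≤ D + i + 1 := by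
  by_contra! h
  -- Modulo all variables the differentials vanish, so a basis vector is a cycle but cannot be a
  -- boundary.
  obtain ⟨u, -, hu⟩ := exists_homogeneous_preimage_mod_variableIdeal hd hex hD le_rfl i h
    (isHomogeneousVector_single (s (i + 1)) b) (fun c => mem_variableIdeal_self.2 (hmin _ _ _))
  have h1 := mem_variableIdeal_self.1 (hu b)
  simp [hmin] at h1

end AcyclicComplexes

/-! ### The mapping cone of a nonzerodivisor -/

section MappingCones

open MvPolynomial

/-- The family `ι` of index types, shifted by one. -/
def ShiftIndex (ι : ℕ → Type) : ℕ → Type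
  | 0 => Empty
  | i + 1 => ι i

instance ShiftIndex.fintype (ι : ℕ → Type) [∀ i, Fintype (ι i)] : ∀ i, Fintype (ShiftIndex ι i)
  | 0 => inferInstanceAs (Fintype Empty)
  | i + 1 => inferInstanceAs (Fintype (ι i))

instance ShiftIndex.decidableEq (ι : ℕ → Type) [∀ i, DecidableEq (ι i)] :
    ∀ i, DecidableEq (ShiftIndex ι i)
  | 0 => inferInstanceAs (DecidableEq Empty)
  | i + 1 => inferInstanceAs (DecidableEq (ι i))

variable {K : Type*} [Field K] {n : ℕ} {ι : ℕ → Type}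

/-- The degrees of the basis elements of a shifted complex. -/
def shiftDegree (s : ∀ i, ι i → ℤ) : ∀ i, ShiftIndex ι i → ℤ
  | 0 => Empty.elim
  | i + 1 => s i

/-- The differential of a shifted complex. -/
def shiftDiff {R : Type*} [CommRing R] (d : ∀ i, (ι (i + 1) → R) →ₗ[R] (ι i → R)) :
    ∀ i, (ι i → R) →ₗ[R] (ShiftIndex ι i → R)
  | 0 => 0
  | i + 1 => d i

/-- The differential of the mapping cone of multiplication by `y`. -/
def coneDiff {R : Type*} [CommRing R] (d : ∀ i, (ι (i + 1) → R) →ₗ[R] (ι i → R)) (y : R) (i : ℕ) :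
    (ι (i + 1) ⊕ ShiftIndex ι (i + 1) → R) →ₗ[R] (ι i ⊕ ShiftIndex ι i → R) where
  toFun v := Sum.elim (d i (fun b => v (Sum.inl b)) + y • (fun b : ι i => v (Sum.inr b)))
    (-(shiftDiff d i (fun b : ι i => v (Sum.inr b))))
  map_add' v w := by
    have h1 : (fun b => (v + w) (Sum.inl b)) = (fun b => v (Sum.inl b)) + fun b => w (Sum.inl b) :=
      rfl
    have h2 : (fun b : ι i => (v + w) (Sum.inr b)) =
      (fun b : ι i => v (Sum.inr b)) + fun b : ι i => w (Sum.inr b) := rfl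
    rw [h1, h2]
    ext (c | c)
    · simp only [map_add, Sum.elim_inl, Pi.add_apply, smul_add]
      abel
    · simp only [map_add, Sum.elim_inr, Pi.add_apply, Pi.neg_apply]
      abel
  map_smul' r v := by
    have h1 : (fun b => (r • v) (Sum.inl b)) = r • (fun b => v (Sum.inl b)) := rfl
    have h2 : (fun b : ι i => (r • v) (Sum.inr b)) = r • (fun b : ι i => v (Sum.inr b)) := rfl
    rw [h1, h2]
    ext (c | c)
    · simp only [map_smul, Sum.elim_inl, Pi.add_apply, Pi.smul_apply, smul_eq_mul,
        RingHom.id_apply]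
      ring
    · simp only [map_smul, Sum.elim_inr, Pi.neg_apply, Pi.smul_apply, smul_eq_mul,
        RingHom.id_apply]
      ring

/-- The vector of the mapping cone with components `u` and `w`. -/
def coneVector {R : Type*} {i : ℕ} (u : ι (i + 1) → R) (w : ι i → R) :
    ι (i + 1) ⊕ ShiftIndex ι (i + 1) → R :=
  Sum.elim u w

theorem exists_eq_coneVector {R : Type*} {i : ℕ} (v : ι (i + 1) ⊕ ShiftIndex ι (i + 1) → R) :
    ∃ u w, v = coneVector u w :=
  ⟨fun b => v (Sum.inl b), fun b => v (Sum.inr b), (Sum.elim_comp_inl_inr v).symm⟩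

theorem coneDiff_coneVector {R : Type*} [CommRing R]
    (d : ∀ i, (ι (i + 1) → R) →ₗ[R] (ι i → R)) (y : R)
    (i : ℕ) (u : ι (i + 1) → R) (w : ι i → R) :
    coneDiff d y i (coneVector u w) = Sum.elim (d i u + y • w) (-(shiftDiff d i w)) := rfl

theorem coneDiff_succ_coneVector {R : Type*} [CommRing R]
    (d : ∀ i, (ι (i + 1) → R) →ₗ[R] (ι i → R)) (y : R)
    (i : ℕ) (u : ι (i + 2) → R) (w : ι (i + 1) → R) :
    coneDiff d y (i + 1) (coneVector u w) = coneVector (d (i + 1) u + y • w) (-(d i w)) := rfl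

theorem shiftDiff_shiftDiff {R : Type*} [CommRing R]
    {d : ∀ i, (ι (i + 1) → R) →ₗ[R] (ι i → R)}
    (hex : ∀ i, LinearMap.range (d (i + 1)) = LinearMap.ker (d i)) (i : ℕ) (v : ι (i + 1) → R) :
    shiftDiff d i (d i v) = 0 := by
  cases i with
  | zero => rfl
  | succ i => exact LinearMap.mem_ker.1 ((hex i).le (LinearMap.mem_range_self _ v))

theorem range_coneDiff {R : Type*} [CommRing R]
    {d : ∀ i, (ι (i + 1) → R) →ₗ[R] (ι i → R)}
    (hex : ∀ i, LinearMap.range (d (i + 1)) = LinearMap.ker (d i)) {y : R}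
    (hy : ∀ v, y • v ∈ LinearMap.range (d 0) → v ∈ LinearMap.range (d 0)) (i : ℕ) :
    LinearMap.range (coneDiff d y (i + 1)) = LinearMap.ker (coneDiff d y i) := by
  have hdd : ∀ i v, d i (d (i + 1) v) = 0 := fun i v =>
    LinearMap.mem_ker.1 ((hex i).le (LinearMap.mem_range_self _ v))
  apply le_antisymm
  · rintro _ ⟨v, rfl⟩
    obtain ⟨u, w, rfl⟩ := exists_eq_coneVector v
    rw [LinearMap.mem_ker, coneDiff_succ_coneVector, coneDiff_coneVector, map_add, hdd, map_neg,
      shiftDiff_shiftDiff hex, map_smul, zero_add, smul_neg, add_neg_cancel, neg_zero, neg_zero]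
    ext (c | c) <;> rfl
  · intro v hv
    obtain ⟨u, w, rfl⟩ := exists_eq_coneVector v
    rw [LinearMap.mem_ker] at hv
    have h1 : d i u + y • w = 0 := funext fun c => congrFun hv (Sum.inl c)
    have h2 : shiftDiff d i w = 0 := funext fun c => by
      have := congrFun hv (Sum.inr c)
      exact neg_eq_zero.1 this
    -- In homological degree `0` this is the nonzerodivisor hypothesis, above it exactness.
    have h3 : w ∈ LinearMap.range (d i) := by
      cases i with
      | zero =>
        refine hy w ⟨-u, ?_⟩
        rw [map_neg, eq_comm, ← add_eq_zero_iff_eq_neg, add_comm]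
        exact h1
      | succ i =>
        rw [hex i]
        exact h2
    obtain ⟨t, rfl⟩ := h3
    have h4 : u + y • t ∈ LinearMap.range (d (i + 1)) := by
      rw [hex, LinearMap.mem_ker, map_add, map_smul]
      exact h1
    obtain ⟨z, hz⟩ := h4
    refine ⟨coneVector z (-t), ?_⟩
    rw [coneDiff_succ_coneVector, hz, map_neg, neg_neg, smul_neg, add_neg_cancel_right]

theorem isHomogeneousMap_coneDiff [∀ i, DecidableEq (ι i)] {s : ∀ i, ι i → ℤ}
    {d : ∀ i, (ι (i + 1) → MvPolynomial (Fin n) K) →ₗ[MvPolynomial (Fin n) K]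
      (ι i → MvPolynomial (Fin n) K)}
    (hd : ∀ i, IsHomogeneousMap (s (i + 1)) (s i) (d i)) {y : MvPolynomial (Fin n) K} {e : ℕ}
    (hy : y.IsHomogeneous e) (i : ℕ) :
    IsHomogeneousMap (Sum.elim (s (i + 1)) fun c => shiftDegree s (i + 1) c + e)
      (Sum.elim (s i) fun c => shiftDegree s i c + e) (coneDiff d y i) := by
  rintro (b | b)
  · have h1 : (Pi.single (Sum.inl b) 1 : ι (i + 1) ⊕ ShiftIndex ι (i + 1) → MvPolynomial (Fin n) K)
        = coneVector (Pi.single b 1) 0 := (Sum.elim_single_zero b 1).symm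
    rw [h1, coneDiff_coneVector, smul_zero, add_zero, map_zero, neg_zero]
    rintro (c | c)
    · exact hd i b c
    · exact IsTwistHomogeneous.zero _ _
  · have h1 : (Pi.single (Sum.inr b) 1 : ι (i + 1) ⊕ ShiftIndex ι (i + 1) → MvPolynomial (Fin n) K)
        = coneVector (ι := ι) (i := i) 0
          (Pi.single (M := fun _ => MvPolynomial (Fin n) K) (i := (b : ι i)) 1) :=
      (Sum.elim_zero_single b 1).symm
    rw [h1, coneDiff_coneVector, map_zero, zero_add]
    rintro (c | c)
    · change IsTwistHomogeneous (s i c) (s i b + e) (y * _)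
      exact (hy.isTwistHomogeneous rfl).mul (isHomogeneousVector_single (s i) b c)
    · refine IsTwistHomogeneous.neg ?_
      cases i with
      | zero => exact c.elim
      | succ i => exact IsTwistHomogeneous.shift (hd i b c) (by simp [shiftDegree])

/-- Let `M = H_0` of a minimal graded free resolution, and let `y` be a form of degree `e > 0`
that is a nonzerodivisor on `M`. If `M / y M` vanishes in degrees `> D`, then the basis elements
in homological degree `i` have degree at most `D + i + 1 - e`. -/
theorem degree_le_of_nonzerodivisor [∀ i, Fintype (ι i)] [∀ i, DecidableEq (ι i)]
    {s : ∀ i, ι i → ℤ}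
    {d : ∀ i, (ι (i + 1) → MvPolynomial (Fin n) K) →ₗ[MvPolynomial (Fin n) K]
      (ι i → MvPolynomial (Fin n) K)}
    (hd : ∀ i, IsHomogeneousMap (s (i + 1)) (s i) (d i))
    (hex : ∀ i, LinearMap.range (d (i + 1)) = LinearMap.ker (d i))
    (hmin : ∀ i v c, constantCoeff (d i v c) = 0)
    {y : MvPolynomial (Fin n) K} {e : ℕ} (hye : y.IsHomogeneous e) (hy0 : constantCoeff y = 0)
    (hy : ∀ v, y • v ∈ LinearMap.range (d 0) → v ∈ LinearMap.range (d 0)) {D : ℤ}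
    (hD : ∀ a, D < a → ∀ v, IsHomogeneousVector (s 0) a v → ∃ u w, v = d 0 u + y • w)
    (i : ℕ) (b : ι i) : s i b + e ≤ D + i + 1 := by
  -- The copy of `b` in the shifted summand lies in homological degree `i + 1` and has degree `s i b
  -- + e`.
  refine degree_le_of_minimal (ι := fun i => ι i ⊕ ShiftIndex ι i)
    (s := fun i => Sum.elim (s i) fun c => shiftDegree s i c + e) (d := coneDiff d y)
    (isHomogeneousMap_coneDiff hd hye) (range_coneDiff hex hy) ?_ ?_ i (Sum.inr b)
  · intro a ha v hv
    obtain ⟨u, w, h⟩ := hD a ha (fun b => v (Sum.inl b)) fun b => hv (Sum.inl b)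
    refine ⟨coneVector u w, ?_⟩
    rw [coneDiff_coneVector, ← h]
    ext (c | c)
    · rfl
    · exact c.elim
  · intro i v c
    obtain ⟨u, w, rfl⟩ := exists_eq_coneVector v
    rw [coneDiff_coneVector]
    rcases c with c | c
    · simp [hmin, hy0]
    · cases i with
      | zero => exact c.elim
      | succ i =>
        exact (map_neg constantCoeff _).trans (neg_eq_zero.2 (hmin i w c))

end MappingCones

/-! ### From a resolution of `I` to one of `R / I` -/

namespace MinimalGradedFreeResolution

open MvPolynomial

variable {K : Type*} [Field K] {N : ℕ} {I : Ideal (MvPolynomial (Fin (N + 1)) K)}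

/-- The ranks in the resolution of `R / I` that extends a resolution of `I`. -/
def quotientRank (F : MinimalGradedFreeResolution I) : ℕ → ℕ
  | 0 => 1
  | i + 1 => F.rank i

/-- The degrees of the basis elements in the resolution of `R / I`. -/
def quotientShift (F : MinimalGradedFreeResolution I) : ∀ i, Fin (F.quotientRank i) → ℤ
  | 0 => 0
  | i + 1 => F.shift i

/-- The differentials in the resolution of `R / I`. -/
noncomputable def quotientDiff (F : MinimalGradedFreeResolution I) : ∀ i,
    (Fin (F.quotientRank (i + 1)) → MvPolynomial (Fin (N + 1)) K) →ₗ[MvPolynomial (Fin (N + 1)) K]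
      (Fin (F.quotientRank i) → MvPolynomial (Fin (N + 1)) K)
  | 0 => LinearMap.pi fun _ => F.aug
  | i + 1 => F.diff i

theorem mem_range_quotientDiff_zero (F : MinimalGradedFreeResolution I)
    (v : Fin (F.quotientRank 0) → MvPolynomial (Fin (N + 1)) K) :
    v ∈ LinearMap.range (F.quotientDiff 0) ↔ v (0 : Fin 1) ∈ I := by
  constructor
  · rintro ⟨u, rfl⟩
    exact F.range_aug.le ⟨u, rfl⟩
  · intro hv
    obtain ⟨u, hu⟩ := F.range_aug.ge hv
    refine ⟨u, funext fun c => ?_⟩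
    obtain rfl : c = (0 : Fin 1) := Subsingleton.elim (α := Fin 1) _ _
    exact hu

/-- A bound for the degrees of a resolution, by means of a nonzerodivisor `y` on `R / I` for
which `R / (I + (y))` vanishes in degrees `> D`. -/
theorem shift_le (F : MinimalGradedFreeResolution I) (hI : ∀ f ∈ I, constantCoeff f = 0)
    {y : MvPolynomial (Fin (N + 1)) K} {e : ℕ} (hye : y.IsHomogeneous e)
    (hy0 : constantCoeff y = 0) (hy : ∀ f, y * f ∈ I → f ∈ I) {D : ℤ}
    (hD : ∀ k : ℕ, D < k → ∀ f : MvPolynomial (Fin (N + 1)) K, f.IsHomogeneous k →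
      ∃ g, f - y * g ∈ I) (i : ℕ) (b : Fin (F.rank i)) :
    F.shift i b + e ≤ D + i + 2 := by
  -- `F_i` is the term of index `i + 1` in the resolution of `R / I`.
  have h := degree_le_of_nonzerodivisor (ι := fun i => Fin (F.quotientRank i))
    (s := F.quotientShift) (d := F.quotientDiff) ?_ ?_ ?_ hye hy0 ?_ ?_ (D := D) (i + 1) b
  · change F.shift i b + e ≤ _ at h
    push_cast at h
    linarith
  · rintro (_ | i) b c
    · exact F.aug_homogeneous b
    · exact F.diff_homogeneous i b c
  · rintro (_ | i)
    · refine F.exact_zero.trans ?_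
      ext v
      change F.aug v = 0 ↔ F.quotientDiff 0 v = 0
      exact ⟨fun h => funext fun _ => h, fun h => congrFun h (0 : Fin 1)⟩
    · exact F.exact_succ i
  · rintro (_ | i) v c
    · exact hI _ (F.range_aug.le ⟨v, rfl⟩)
    · exact F.minimal i v c
  · intro v hv
    rw [mem_range_quotientDiff_zero] at *
    exact hy _ hv
  · intro a ha v hv
    obtain ⟨g, hg⟩ : ∃ g, v (0 : Fin 1) - y * g ∈ I := by
      rcases hv (0 : Fin 1) with h | ⟨k, hk, hk'⟩
      · exact ⟨0, by rw [h]; simp⟩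
      · refine hD k ?_ _ hk'
        have h0 : a = 0 + (k : ℤ) := hk
        omega
    obtain ⟨u, hu⟩ := (F.mem_range_quotientDiff_zero (v - y • fun _ => g)).2 hg
    exact ⟨u, fun _ => g, by rw [hu]; abel⟩

end MinimalGradedFreeResolution

/-! ### Existence of minimal graded free resolutions -/

section ExistenceOfResolutions

open MvPolynomial

variable {K : Type*} [Field K] {σ : Type*} {n : ℕ}

/-- A submodule of a graded free module which contains the components of its elements. -/
def IsGradedSubmodule (s : Fin n → ℤ)
    (Z : Submodule (MvPolynomial σ K) (Fin n → MvPolynomial σ K)) : Prop :=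
  ∀ v ∈ Z, ∀ e, gradedPart s e v ∈ Z

theorem isGradedSubmodule_ker {m : ℕ} {s : Fin m → ℤ} {t : Fin n → ℤ}
    {φ : (Fin m → MvPolynomial σ K) →ₗ[MvPolynomial σ K] (Fin n → MvPolynomial σ K)}
    (hφ : IsHomogeneousMap s t φ) : IsGradedSubmodule s (LinearMap.ker φ) := by
  intro v hv e
  rw [LinearMap.mem_ker] at *
  rw [← gradedPart_map hφ, hv]
  ext1 c
  simp [gradedPart]

theorem isHomogeneousMap_linearCombination {m : ℕ} {s : Fin m → ℤ} {t : Fin n → ℤ}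
    {g : Fin m → Fin n → MvPolynomial σ K} (hg : ∀ b, IsHomogeneousVector t (s b) (g b)) :
    IsHomogeneousMap s t (Fintype.linearCombination (MvPolynomial σ K) g) := by
  intro b
  rw [Fintype.linearCombination_apply_single, one_smul]
  exact hg b

theorem IsGradedSubmodule.exists_generators [Finite σ] {s : Fin n → ℤ}
    {Z : Submodule (MvPolynomial σ K) (Fin n → MvPolynomial σ K)} (hZ : IsGradedSubmodule s Z) :
    ∃ (m : ℕ) (t : Fin m → ℤ) (g : Fin m → Fin n → MvPolynomial σ K),
      (∀ b, IsHomogeneousVector s (t b) (g b)) ∧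
        Submodule.span (MvPolynomial σ K) (Set.range g) = Z := by
  have hspan :
      Submodule.span (MvPolynomial σ K) {v | v ∈ Z ∧ ∃ e, IsHomogeneousVector s e v} = Z := by
    apply le_antisymm
    · exact Submodule.span_le.2 fun v hv => hv.1
    · intro v hv
      obtain ⟨T, hT⟩ := exists_sum_gradedPart s v
      rw [hT]
      exact Submodule.sum_mem _ fun e _ => Submodule.subset_span
        ⟨hZ v hv e, e, isHomogeneousVector_gradedPart s e v⟩
  have hfg : Z.FG := IsNoetherian.noetherian Z
  rw [← hspan, Submodule.fg_span_iff_fg_span_finset_subset] at hfg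
  obtain ⟨S, hS, hSZ⟩ := hfg
  choose! t ht using fun v (hv : v ∈ (S : Set (Fin n → MvPolynomial σ K))) => (hS hv).2
  refine ⟨S.card, fun b => t (S.equivFin.symm b), fun b => S.equivFin.symm b, fun b => ?_, ?_⟩
  · exact ht _ (S.equivFin.symm b).2
  · rw [← hspan, hSZ]
    congr 1
    ext v
    constructor
    · rintro ⟨b, rfl⟩
      exact (S.equivFin.symm b).2
    · intro hv
      exact ⟨S.equivFin ⟨v, hv⟩, by simp⟩

/-- A graded submodule of a graded free module is the image of a homogeneous map of graded free
modules whose kernel has no element with a nonzero constant coefficient. -/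
theorem IsGradedSubmodule.exists_minimal_cover [Finite σ] {s : Fin n → ℤ}
    {Z : Submodule (MvPolynomial σ K) (Fin n → MvPolynomial σ K)} (hZ : IsGradedSubmodule s Z) :
    ∃ (m : ℕ) (t : Fin m → ℤ)
      (φ : (Fin m → MvPolynomial σ K) →ₗ[MvPolynomial σ K] (Fin n → MvPolynomial σ K)),
      IsHomogeneousMap t s φ ∧ LinearMap.range φ = Z ∧
        ∀ v ∈ LinearMap.ker φ, ∀ c, constantCoeff (v c) = 0 := by
  classical
  have hex := hZ.exists_generators
  -- Take the least number of homogeneous generators; a relation with a nonzero constant coefficient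
  -- would make one of them redundant.
  obtain ⟨t, g, hg, hgZ⟩ := Nat.find_spec hex
  have hmin := fun m (hm : m < Nat.find hex) => Nat.find_min hex hm
  generalize Nat.find hex = m at *
  refine ⟨m, t, Fintype.linearCombination (MvPolynomial σ K) g,
    isHomogeneousMap_linearCombination hg, ?_, ?_⟩
  · rw [Fintype.range_linearCombination, hgZ]
  · intro v hv c
    by_contra hc
    cases m with
    | zero => exact c.elim0
    | succ m =>
      refine hmin m m.lt_succ_self ⟨fun b => t (c.succAbove b), fun b => g (c.succAbove b),
        fun b => hg _, ?_⟩
      rw [← hgZ]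
      apply le_antisymm
      · apply Submodule.span_mono
        rintro _ ⟨b, rfl⟩
        exact ⟨_, rfl⟩
      · rw [Submodule.span_le]
        rintro _ ⟨b, rfl⟩
        have hmem : ∀ b, g (c.succAbove b) ∈ Submodule.span (MvPolynomial σ K)
            (Set.range fun b => g (c.succAbove b)) := fun b => Submodule.subset_span ⟨b, rfl⟩
        obtain rfl | ⟨b, rfl⟩ := c.eq_self_or_eq_succAbove b
        -- The component of the relation in the degree of `g b` has a nonzero scalar as coefficient
        -- of `g b`, so `g b` can be solved for.
        · have h1 := isGradedSubmodule_ker (isHomogeneousMap_linearCombination hg) v hv (t b)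
          rw [LinearMap.mem_ker, Fintype.linearCombination_apply, Fin.sum_univ_succAbove _ b] at h1
          have h2 : gradedPart t (t b) v b = C (constantCoeff (v b)) := by
            rw [gradedPart, sub_self, constantCoeff_twistComponent_zero]
          rw [h2] at h1
          have h3 : g b = (C (constantCoeff (v b))⁻¹ : MvPolynomial σ K) •
              ((C (constantCoeff (v b)) : MvPolynomial σ K) • g b) := by
            rw [smul_smul, ← C_mul, inv_mul_cancel₀ hc, C_1, one_smul]
          rw [h3, eq_neg_of_add_eq_zero_left h1]
          exact Submodule.smul_mem _ _ (Submodule.neg_mem _ (Submodule.sum_mem _ fun i _ =>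
            Submodule.smul_mem _ _ (hmem i)))
        · exact hmem b

/-- A graded submodule of a graded free module of finite rank. -/
structure GradedSubmodule (σ K : Type*) [Field K] where
  /-- the rank of the free module -/
  rank : ℕ
  /-- the degrees of the basis elements -/
  shift : Fin rank → ℤ
  /-- the submodule -/
  carrier : Submodule (MvPolynomial σ K) (Fin rank → MvPolynomial σ K)
  isGraded : IsGradedSubmodule shift carrier

namespace GradedSubmodule

variable [Finite σ]

/-- The rank of a minimal cover. -/
noncomputable def coverRank (Z : GradedSubmodule σ K) : ℕ :=
  Z.isGraded.exists_minimal_cover.choose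

/-- The degrees of the basis elements of a minimal cover. -/
noncomputable def coverShift (Z : GradedSubmodule σ K) : Fin Z.coverRank → ℤ :=
  Z.isGraded.exists_minimal_cover.choose_spec.choose

/-- A minimal cover of a graded submodule by a graded free module. -/
noncomputable def cover (Z : GradedSubmodule σ K) :
    (Fin Z.coverRank → MvPolynomial σ K) →ₗ[MvPolynomial σ K] (Fin Z.rank → MvPolynomial σ K) :=
  Z.isGraded.exists_minimal_cover.choose_spec.choose_spec.choose

theorem isHomogeneousMap_cover (Z : GradedSubmodule σ K) :
    IsHomogeneousMap Z.coverShift Z.shift Z.cover :=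
  Z.isGraded.exists_minimal_cover.choose_spec.choose_spec.choose_spec.1

theorem range_cover (Z : GradedSubmodule σ K) : LinearMap.range Z.cover = Z.carrier :=
  Z.isGraded.exists_minimal_cover.choose_spec.choose_spec.choose_spec.2.1

theorem constantCoeff_of_mem_ker_cover (Z : GradedSubmodule σ K)
    (v : Fin Z.coverRank → MvPolynomial σ K) (hv : v ∈ LinearMap.ker Z.cover)
    (c : Fin Z.coverRank) : constantCoeff (v c) = 0 :=
  Z.isGraded.exists_minimal_cover.choose_spec.choose_spec.choose_spec.2.2 v hv c

/-- The first syzygy module of a graded submodule. -/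
noncomputable def syzygy (Z : GradedSubmodule σ K) : GradedSubmodule σ K where
  rank := Z.coverRank
  shift := Z.coverShift
  carrier := LinearMap.ker Z.cover
  isGraded := isGradedSubmodule_ker Z.isHomogeneousMap_cover

/-- The iterated syzygy modules of a graded submodule. -/
noncomputable def iterSyzygy (Z : GradedSubmodule σ K) : ℕ → GradedSubmodule σ K
  | 0 => Z
  | i + 1 => (Z.iterSyzygy i).syzygy

end GradedSubmodule

/-- An ideal with a homogeneous structure, as a graded submodule of a free module of rank one. -/
noncomputable def idealGradedSubmodule (I : Ideal (MvPolynomial σ K))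
    (hI : ∀ f ∈ I, ∀ e, twistComponent e f ∈ I) : GradedSubmodule σ K where
  rank := 1
  shift := 0
  carrier := Submodule.comap (LinearMap.proj 0) I
  isGraded := by
    intro v hv e
    exact hI _ hv _

theorem nonempty_minimalGradedFreeResolution {N : ℕ} (I : Ideal (MvPolynomial (Fin (N + 1)) K))
    (hI : ∀ f ∈ I, ∀ e, twistComponent e f ∈ I) : Nonempty (MinimalGradedFreeResolution I) := by
  let Z := idealGradedSubmodule I hI
  refine ⟨{
    -- The ambient free module of the syzygy of index `i + 1` is the source of the cover of index
    -- `i`.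
    rank := fun i => (Z.iterSyzygy (i + 1)).rank
    shift := fun i => (Z.iterSyzygy (i + 1)).shift
    aug := (LinearMap.proj (0 : Fin 1)).comp Z.cover
    diff := fun i => (Z.iterSyzygy (i + 1)).cover
    aug_homogeneous := fun b => Z.isHomogeneousMap_cover b (0 : Fin 1)
    diff_homogeneous := fun i b c => (Z.iterSyzygy (i + 1)).isHomogeneousMap_cover b c
    range_aug := ?_
    exact_zero := ?_
    exact_succ := fun i => (Z.iterSyzygy (i + 2)).range_cover
    minimal := fun i v c => (Z.iterSyzygy i).constantCoeff_of_mem_ker_cover _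
      ((Z.iterSyzygy (i + 1)).range_cover.le ⟨v, rfl⟩) c }⟩
  · refine (LinearMap.range_comp _ _).trans ?_
    refine (congrArg (Submodule.map (LinearMap.proj (0 : Fin 1))) Z.range_cover).trans ?_
    refine Submodule.map_comap_eq_of_surjective ?_ I
    exact LinearMap.proj_surjective (0 : Fin 1)
  · refine (Z.iterSyzygy 1).range_cover.trans ?_
    ext v
    change Z.cover v = 0 ↔ Z.cover v (0 : Fin 1) = 0
    refine ⟨fun h => congrFun h _, fun h => funext fun c => ?_⟩
    obtain rfl : c = (0 : Fin 1) := Subsingleton.elim (α := Fin 1) _ _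
    exact h

end ExistenceOfResolutions

/-! ### Linear forms and evaluation -/

section LinearForms

open MvPolynomial

variable {K : Type*} [Field K]

/-- The polynomial of a linear functional in coordinate space. -/
noncomputable def linearForm {σ : Type*} [Fintype σ] [DecidableEq σ] (φ : (σ → K) →ₗ[K] K) :
    MvPolynomial σ K :=
  ∑ j, C (φ (Pi.single j 1)) * X j

theorem isHomogeneous_linearForm {σ : Type*} [Fintype σ] [DecidableEq σ] (φ : (σ → K) →ₗ[K] K) :
    (linearForm φ).IsHomogeneous 1 :=
  IsHomogeneous.sum _ _ _ fun j _ => isHomogeneous_C_mul_X _ j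

theorem eval_linearForm {σ : Type*} [Fintype σ] [DecidableEq σ] (φ : (σ → K) →ₗ[K] K) (v : σ → K) :
    eval v (linearForm φ) = φ v := by
  conv_rhs => rw [pi_eq_sum_univ' v]
  simp [linearForm, map_sum, mul_comm]

theorem MvPolynomial.IsHomogeneous.eval_smul {σ : Type*} [Fintype σ] {f : MvPolynomial σ K} {d : ℕ}
    (hf : f.IsHomogeneous d) (a : K) (v : σ → K) : eval (a • v) f = a ^ d * eval v f := by
  rw [eval_eq', eval_eq', Finset.mul_sum]
  refine Finset.sum_congr rfl fun m hm => ?_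
  have h1 : ∑ i, m i = d := by
    by_contra h
    refine mem_support_iff.1 hm (hf.coeff_eq_zero ?_)
    rwa [Finsupp.degree_eq_sum]
  simp only [Pi.smul_apply, smul_eq_mul, mul_pow]
  rw [Finset.prod_mul_distrib, Finset.prod_pow_eq_pow_sum, h1]
  ring

end LinearForms

/-! ### Homogeneous ideals of sets of points -/

section IdealsOfPoints

open MvPolynomial

variable {K : Type*} [Field K] {N : ℕ} {S : Set (Projectivization K (Fin (N + 1) → K))}

theorem eval_eq_zero_of_mem_pointsIdeal {f : MvPolynomial (Fin (N + 1)) K} (hf : f ∈ pointsIdeal S)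
    {v : Fin (N + 1) → K} (hv : v ≠ 0) (hS : Projectivization.mk K v hv ∈ S) : eval v f = 0 := by
  have : pointsIdeal S ≤ RingHom.ker (eval v) := by
    refine Ideal.span_le.2 fun g hg => ?_
    exact hg.2 v hv hS
  exact this hf

theorem eval_rep_eq_zero_of_mem_pointsIdeal {f : MvPolynomial (Fin (N + 1)) K}
    (hf : f ∈ pointsIdeal S) {p : Projectivization K (Fin (N + 1) → K)} (hp : p ∈ S) :
    eval p.rep f = 0 :=
  eval_eq_zero_of_mem_pointsIdeal hf p.rep_nonzero (by rwa [p.mk_rep])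

/-- Rescaling a vector multiplies the value of a form by a power of the scalar, so one
representative per point suffices. -/
theorem mem_pointsIdeal_of_eval_rep {f : MvPolynomial (Fin (N + 1)) K} {d : ℕ}
    (hf : f.IsHomogeneous d) (h : ∀ p ∈ S, eval p.rep f = 0) : f ∈ pointsIdeal S := by
  refine Ideal.subset_span ⟨⟨d, hf⟩, fun v hv hvS => ?_⟩
  obtain ⟨a, ha⟩ := Projectivization.exists_smul_eq_mk_rep K v hv
  have h1 := h _ hvS
  rw [← ha, Units.smul_def, hf.eval_smul] at h1
  exact (mul_eq_zero.1 h1).resolve_left (pow_ne_zero _ a.ne_zero)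

attribute [local instance] MvPolynomial.gradedAlgebra in
theorem isHomogeneous_pointsIdeal (S : Set (Projectivization K (Fin (N + 1) → K))) :
    (pointsIdeal S).IsHomogeneous (homogeneousSubmodule (Fin (N + 1)) K) :=
  Ideal.homogeneous_span _ _ fun _ hf => hf.1

theorem homogeneousComponent_mem_pointsIdeal {f : MvPolynomial (Fin (N + 1)) K}
    (hf : f ∈ pointsIdeal S) (n : ℕ) : homogeneousComponent n f ∈ pointsIdeal S :=
  homogeneousComponent_mem_of_mem (isHomogeneous_pointsIdeal S) hf n

theorem twistComponent_mem_pointsIdeal {f : MvPolynomial (Fin (N + 1)) K}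
    (hf : f ∈ pointsIdeal S) (n : ℤ) : twistComponent n f ∈ pointsIdeal S := by
  unfold twistComponent
  split_ifs
  · exact homogeneousComponent_mem_pointsIdeal hf _
  · exact zero_mem _

/-- The degree `0` component also lies in the ideal, and a constant vanishing at a point is zero. -/
theorem constantCoeff_eq_zero_of_mem_pointsIdeal (hS : S.Nonempty)
    {f : MvPolynomial (Fin (N + 1)) K} (hf : f ∈ pointsIdeal S) : constantCoeff f = 0 := by
  obtain ⟨p, hp⟩ := hS
  have h := eval_rep_eq_zero_of_mem_pointsIdeal (twistComponent_mem_pointsIdeal hf 0) hp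
  rwa [constantCoeff_twistComponent_zero, eval_C] at h

/-- A form without zeros in `S` is a nonzerodivisor modulo the ideal of `S`. -/
theorem mem_pointsIdeal_of_mul_mem {y : MvPolynomial (Fin (N + 1)) K} {e : ℕ}
    (hy : y.IsHomogeneous e) (hyS : ∀ p ∈ S, eval p.rep y ≠ 0) {f : MvPolynomial (Fin (N + 1)) K}
    (hf : y * f ∈ pointsIdeal S) : f ∈ pointsIdeal S := by
  rw [mem_iff_homogeneousComponent_mem (isHomogeneous_pointsIdeal S)]
  intro n
  refine mem_pointsIdeal_of_eval_rep (homogeneousComponent_isHomogeneous n f) fun p hp => ?_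
  have h1 := eval_rep_eq_zero_of_mem_pointsIdeal (twistComponent_mem_pointsIdeal hf (n + e)) hp
  rw [mul_comm, twistComponent_mul (n := n) (hy.isTwistHomogeneous (a := 0) rfl) f (by simp),
    map_mul] at h1
  simpa [twistComponent] using (mul_eq_zero.1 h1).resolve_right (hyS p hp)

end IdealsOfPoints

/-! ### Separating forms and interpolation over a finite field -/

section Separators

open MvPolynomial

universe u

variable {K : Type u} [Field K] {N : ℕ}

theorem exists_basis_rep_pair {p q : Projectivization K (Fin (N + 1) → K)} (hpq : p ≠ q) :
    ∃ (ι : Type u) (_ : Fintype ι) (b : Module.Basis ι K (Fin (N + 1) → K)) (i j : ι),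
      i ≠ j ∧ b i = p.rep ∧ b j = q.rep := by
  have h1 : LinearIndependent K ![p.rep, q.rep] := by
    have h := Projectivization.independent_iff.1
      ((Projectivization.independent_pair_iff_ne p q).2 hpq)
    have h' : Projectivization.rep ∘ ![p, q] = ![p.rep, q.rep] := by
      ext i : 1
      fin_cases i <;> rfl
    rwa [h'] at h
  have hid := h1.linearIndepOn_id
  let b := Module.Basis.extend hid
  refine ⟨_, FiniteDimensional.fintypeBasisIndex b, b,
    ⟨p.rep, Module.Basis.subset_extend hid ⟨0, rfl⟩⟩,
    ⟨q.rep, Module.Basis.subset_extend hid ⟨1, rfl⟩⟩, ?_, ?_, ?_⟩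
  · intro h
    exact hpq (by rw [← p.mk_rep, ← q.mk_rep]; simp only [Subtype.mk.injEq] at h; simp only [h])
  · exact Module.Basis.extend_apply_self hid _
  · exact Module.Basis.extend_apply_self hid _

theorem eq_of_rep_eq_smul {p r : Projectivization K (Fin (N + 1) → K)} {a : K}
    (h : r.rep = a • p.rep) : r = p := by
  rw [← r.mk_rep, ← p.mk_rep, Projectivization.mk_eq_mk_iff']
  exact ⟨a, h.symm⟩

variable [Fintype K]

/-- Forms of degree `d ≥ N (s - 1)` which take the value `1` at `p` and vanish at all points except
`p` and `q`; they vanish at `q` as well if `d > N (s - 1)`. -/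
theorem exists_separator {p q : Projectivization K (Fin (N + 1) → K)} (hpq : p ≠ q) {d : ℕ}
    (hd : N * (Fintype.card K - 1) ≤ d) :
    ∃ g : MvPolynomial (Fin (N + 1)) K, g.IsHomogeneous d ∧ eval p.rep g = 1 ∧
      (∀ r, r ≠ p → r ≠ q → eval r.rep g = 0) ∧
        (N * (Fintype.card K - 1) < d → eval q.rep g = 0) := by
  classical
  obtain ⟨ι, _, b, i, j, hij, hi, hj⟩ := exists_basis_rep_pair hpq
  set t := Fintype.card K - 1 with ht
  have ht0 : t ≠ 0 := by
    have := Fintype.one_lt_card (α := K)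
    omega
  have hpow : ∀ a : K, a ≠ 0 → a ^ t = 1 := fun a ha => FiniteField.pow_card_sub_one_eq_one a ha
  have hcard : Fintype.card ι = N + 1 := by
    rw [← Module.finrank_eq_card_basis b]
    simp
  let T : Finset ι := (Finset.univ.erase i).erase j
  have hT : T.card + 1 = N := by
    have h1 : j ∈ Finset.univ.erase i := Finset.mem_erase.2 ⟨hij.symm, Finset.mem_univ j⟩
    have h2 : T.card + 1 = _ := Finset.card_erase_add_one h1
    have h3 := Finset.card_erase_add_one (Finset.mem_univ i)
    rw [Finset.card_univ, hcard] at h3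
    omega
  let l : ι → MvPolynomial (Fin (N + 1)) K := fun k => linearForm (b.coord k)
  have hl : ∀ k v, eval v (l k) = b.repr v k := fun k v => eval_linearForm _ _
  have hlt : ∀ k, (l k ^ t).IsHomogeneous t := fun k => by
    simpa using (isHomogeneous_linearForm (b.coord k)).pow t
  -- In coordinates with `p = e_i` and `q = e_j`, the powers `l ^ t` take only the values `0` and
  -- `1`. The first factor vanishes unless exactly one of `l i`, `l j` is nonzero; then `l i ^ t + l
  -- j ^ t = 1`, and a third nonzero coordinate kills the product. There are `1 + (N - 1)` factors
  -- of degree `t`; the last power adjusts the degree and vanishes at `q` when its exponent is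
  -- positive.
  let g := (l i ^ t - l j ^ t) * (∏ k ∈ T, (l i ^ t + l j ^ t - l k ^ t)) * l i ^ (d - N * t)
  have hg : ∀ v, eval v g = (b.repr v i ^ t - b.repr v j ^ t) *
      (∏ k ∈ T, (b.repr v i ^ t + b.repr v j ^ t - b.repr v k ^ t)) *
        b.repr v i ^ (d - N * t) := by
    intro v
    simp only [g, map_mul, map_sub, map_add, map_pow, map_prod, hl]
  have hpi : ∀ k, b.repr p.rep k = if k = i then 1 else 0 := fun k => by
    rw [← hi, Module.Basis.repr_self, Finsupp.single_apply]
    exact if_congr eq_comm rfl rfl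
  have hqj : ∀ k, b.repr q.rep k = if k = j then 1 else 0 := fun k => by
    rw [← hj, Module.Basis.repr_self, Finsupp.single_apply]
    exact if_congr eq_comm rfl rfl
  refine ⟨g, ?_, ?_, ?_, ?_⟩
  · have h1 := (((hlt i).sub (hlt j)).mul (IsHomogeneous.prod T _ (fun _ => t)
      fun k _ => ((hlt i).add (hlt j)).sub (hlt k))).mul
      ((isHomogeneous_linearForm (b.coord i)).pow (d - N * t))
    have h2 : N * t = t + T.card * t := by
      rw [← hT]
      ring
    rw [Finset.sum_const, smul_eq_mul, one_mul, ← h2, Nat.add_sub_cancel' hd] at h1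
    exact h1
  · rw [hg, Finset.prod_eq_one, hpi, hpi]
    · simp [hij.symm, ht0]
    · intro k hk
      simp only [T, Finset.mem_erase] at hk
      rw [hpi, hpi, hpi]
      simp [hij.symm, ht0, hk.2.1]
  · intro r hrp hrq
    rw [hg]
    have hsum := b.sum_repr r.rep
    refine mul_eq_zero_of_left ?_ _
    -- Stated for `i'` and `j'` so that it serves both cases: only `l i` nonzero, or only `l j`.
    have key : ∀ i' j' : ι, b.repr r.rep j' = 0 → b.repr r.rep i' ^ t + b.repr r.rep j' ^ t = 1 →
        (∀ k, k ≠ i' → k ≠ j' → k ∈ T) → (∀ a : K, r.rep ≠ a • b i') →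
        ∏ k ∈ T, (b.repr r.rep i' ^ t + b.repr r.rep j' ^ t - b.repr r.rep k ^ t) = 0 := by
      intro i' j' h1 h2 h3 h4
      have h5 : ∃ k, k ≠ i' ∧ b.repr r.rep k ≠ 0 := by
        by_contra! h
        refine h4 (b.repr r.rep i') ?_
        conv_lhs => rw [← hsum]
        refine Finset.sum_eq_single i' (fun k _ hk => ?_) fun h' => absurd (Finset.mem_univ _) h'
        rw [h k hk, zero_smul]
      obtain ⟨k, hk, hk0⟩ := h5
      refine Finset.prod_eq_zero (h3 k hk fun h => hk0 (h ▸ h1)) ?_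
      rw [h2, hpow _ hk0, sub_self]
    by_cases h1 : b.repr r.rep i = 0 <;> by_cases h2 : b.repr r.rep j = 0
    · simp [h1, h2]
    · refine mul_eq_zero_of_right _ ?_
      have := key j i h1 (by rw [h1, hpow _ h2, zero_pow ht0, add_zero])
        (fun k hkj hki => by simp [T, hkj, hki]) (fun a ha => hrq (eq_of_rep_eq_smul (hj ▸ ha)))
      simpa only [add_comm] using this
    · refine mul_eq_zero_of_right _ ?_
      exact key i j h2 (by rw [h2, hpow _ h1, zero_pow ht0, add_zero])
        (fun k hki hkj => by simp [T, hkj, hki]) (fun a ha => hrp (eq_of_rep_eq_smul (hi ▸ ha)))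
    · rw [hpow _ h1, hpow _ h2, sub_self, zero_mul]
  · intro hlt'
    rw [hg, hqj i, if_neg hij, zero_pow (by omega : d - N * t ≠ 0), mul_zero]

/-- All functions on the complement of `q` are values of forms of degree `d ≥ N (s - 1)`. -/
theorem exists_interpolation (q : Projectivization K (Fin (N + 1) → K)) {d : ℕ}
    (hd : N * (Fintype.card K - 1) ≤ d) (c : Projectivization K (Fin (N + 1) → K) → K) :
    ∃ g : MvPolynomial (Fin (N + 1)) K, g.IsHomogeneous d ∧ ∀ p ≠ q, eval p.rep g = c p := by
  classical
  have := Fintype.ofFinite (Projectivization K (Fin (N + 1) → K))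
  choose! g hg1 hg2 hg3 _ using
    fun (p : Projectivization K (Fin (N + 1) → K)) (hp : p ≠ q) => exists_separator hp hd
  refine ⟨∑ p ∈ Finset.univ.erase q, C (c p) * g p, ?_, fun p hp => ?_⟩
  · exact IsHomogeneous.sum _ _ _ fun p hp => (hg1 p (Finset.ne_of_mem_erase hp)).C_mul _
  · rw [map_sum, Finset.sum_eq_single p]
    · rw [map_mul, eval_C, hg2 p hp, mul_one]
    · intro r hr hrp
      rw [map_mul, hg3 r (Finset.ne_of_mem_erase hr) p hrp.symm hp, mul_zero]
    · intro h
      exact absurd (Finset.mem_erase.2 ⟨hp, Finset.mem_univ p⟩) h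

/-- A form of degree `N (s - 1)` that vanishes at all points except `q` vanishes at `q`. -/
theorem eval_rep_eq_zero_of_isHomogeneous (hN : 1 ≤ N)
    {q : Projectivization K (Fin (N + 1) → K)} {f : MvPolynomial (Fin (N + 1)) K}
    (hf : f.IsHomogeneous (N * (Fintype.card K - 1))) (hfI : f ∈ pointsIdeal {q}ᶜ) :
    eval q.rep f = 0 := by
  classical
  have hs := Fintype.one_lt_card (α := K)
  have ht : 0 < Fintype.card K - 1 := by omega
  have h1 : ∑ v, eval v f = 0 := by
    -- The degree `N (s - 1)` is less than `(N + 1) (s - 1)`.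
    refine sum_eval_eq_zero f (hf.totalDegree_le.trans_lt ?_)
    rw [Fintype.card_fin]
    nlinarith
  -- Only nonzero multiples of `q.rep` contribute, all equally, since the degree is a positive
  -- multiple of `s - 1`.
  have h2 : ∑ a : Kˣ, eval q.rep f = ∑ v, eval v f := by
    refine Fintype.sum_of_injective (fun a : Kˣ => a • q.rep) ?_ _ _ ?_ ?_
    · intro a a' h
      exact Units.ext (smul_left_injective K q.rep_nonzero h)
    · intro v hv
      by_cases hv0 : v = 0
      · have := hf.eval_smul 0 v
        rw [zero_smul, zero_pow (by positivity), zero_mul] at this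
        rw [hv0, this]
      · refine eval_eq_zero_of_mem_pointsIdeal hfI hv0 fun h => hv ?_
        rw [Set.mem_singleton_iff] at h
        obtain ⟨a, ha⟩ := Projectivization.exists_smul_eq_mk_rep K v hv0
        refine ⟨a⁻¹, ?_⟩
        change a⁻¹ • q.rep = v
        rw [← h, ← ha, inv_smul_smul]
    · intro a
      rw [Units.smul_def, hf.eval_smul, mul_comm N, pow_mul,
        FiniteField.pow_card_sub_one_eq_one _ a.ne_zero, one_pow, one_mul]
  -- The number of units is `s - 1`, which is `-1` in `K`.
  rw [h1, Finset.sum_const, Finset.card_univ, Fintype.card_units, nsmul_eq_mul,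
    Nat.cast_sub hs.le, FiniteField.cast_card_eq_zero] at h2
  simpa using h2

/-- Multiplying by a power of a coordinate that is nonzero at `q` raises the degree to `N (s - 1)`.
-/
theorem eval_rep_eq_zero_of_isHomogeneous_of_le (hN : 1 ≤ N)
    {q : Projectivization K (Fin (N + 1) → K)} {f : MvPolynomial (Fin (N + 1)) K} {d : ℕ}
    (hf : f.IsHomogeneous d) (hd : d ≤ N * (Fintype.card K - 1)) (hfI : f ∈ pointsIdeal {q}ᶜ) :
    eval q.rep f = 0 := by
  obtain ⟨j, hj⟩ := Function.ne_iff.1 q.rep_nonzero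
  have h := eval_rep_eq_zero_of_isHomogeneous hN
    (f := f * X j ^ (N * (Fintype.card K - 1) - d)) (q := q) (by
      convert hf.mul (isHomogeneous_X_pow j (N * (Fintype.card K - 1) - d)) using 1
      omega) (Ideal.mul_mem_right _ _ hfI)
  rw [map_mul, map_pow, eval_X] at h
  exact (mul_eq_zero.1 h).resolve_right (pow_ne_zero _ hj)

end Separators

/-! ### The two bounds for the regularity -/

section Regularity

open MvPolynomial

variable {K : Type*} [Field K] {N : ℕ}

theorem exists_point_ne (hN : 1 ≤ N) (q : Projectivization K (Fin (N + 1) → K)) : ∃ p, p ≠ q := by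
  have : Nontrivial (Fin (N + 1)) := Fin.nontrivial_iff_two_le.2 (by omega)
  by_contra! h
  have h0 : (Pi.single 0 1 : Fin (N + 1) → K) ≠ 0 := by simp
  have h1 : (Pi.single (Fin.last N) 1 : Fin (N + 1) → K) ≠ 0 := by simp
  have h2 := (h (Projectivization.mk K _ h0)).trans (h (Projectivization.mk K _ h1)).symm
  rw [Projectivization.mk_eq_mk_iff'] at h2
  obtain ⟨a, ha⟩ := h2
  have h3 := congrFun ha 0
  have h4 : (0 : Fin (N + 1)) ≠ Fin.last N := by
    rw [Ne, Fin.ext_iff]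
    simp
    omega
  simp [h4] at h3

variable [Fintype K]

theorem shift_sub_le (hN : 1 ≤ N) {q : Projectivization K (Fin (N + 1) → K)}
    (F : MinimalGradedFreeResolution (pointsIdeal ({q}ᶜ : Set (Projectivization K _))))
    (i : ℕ) (b : Fin (F.rank i)) :
    F.shift i b - i ≤ (N : ℤ) * ((Fintype.card K : ℤ) - 1) + 1 := by
  have hs := Fintype.one_lt_card (α := K)
  set e := N * (Fintype.card K - 1) with he
  have he0 : 0 < e := Nat.mul_pos hN (by omega)
  have heZ : (e : ℤ) = (N : ℤ) * ((Fintype.card K : ℤ) - 1) := by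
    rw [he]
    push_cast [Nat.cast_sub hs.le]
    ring
  obtain ⟨y, hye, hy⟩ := exists_interpolation q (d := e) le_rfl fun _ => 1
  obtain ⟨p, hp⟩ := exists_point_ne hN q
  have h := F.shift_le (fun f => constantCoeff_eq_zero_of_mem_pointsIdeal ⟨p, hp⟩) hye
    (hye.coeff_eq_zero (by simpa using he0.ne))
    (fun f => mem_pointsIdeal_of_mul_mem hye fun p hp => by rw [hy p hp]; exact one_ne_zero)
    -- For `k ≥ 2e` the degree `k - e` is still at least `e`, so interpolation applies to the
    -- cofactor of `y`.
    (D := e + e - 1) (fun k hk f hf => by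
      obtain ⟨g, hg, hgf⟩ := exists_interpolation q (d := k - e) (by omega) fun p => eval p.rep f
      refine ⟨g, mem_pointsIdeal_of_eval_rep (d := k) (hf.sub ?_) fun p hp => ?_⟩
      · have := hye.mul hg
        rwa [Nat.add_sub_cancel' (by omega)] at this
      · rw [map_sub, map_mul, hy p hp, hgf p hp, one_mul, sub_self]) i b
  omega

theorem exists_le_shift_zero (hN : 1 ≤ N) {q : Projectivization K (Fin (N + 1) → K)}
    (F : MinimalGradedFreeResolution (pointsIdeal ({q}ᶜ : Set (Projectivization K _)))) :
    ∃ b : Fin (F.rank 0), (N : ℤ) * ((Fintype.card K : ℤ) - 1) + 1 ≤ F.shift 0 b := by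
  have hs := Fintype.one_lt_card (α := K)
  set e := N * (Fintype.card K - 1) with he
  have heZ : (e : ℤ) = (N : ℤ) * ((Fintype.card K : ℤ) - 1) := by
    rw [he]
    push_cast [Nat.cast_sub hs.le]
    ring
  by_contra! hb
  obtain ⟨p, hp⟩ := exists_point_ne hN q
  -- The separator takes the value `1` at `q`; degree `e + 1` makes it vanish at the auxiliary point
  -- `p` too, so it lies in `I`.
  obtain ⟨g, hg, hgq, hgr, hgp⟩ := exists_separator hp.symm (d := e + 1) (by omega)
  have hgI : g ∈ pointsIdeal ({q}ᶜ : Set (Projectivization K (Fin (N + 1) → K))) := by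
    refine mem_pointsIdeal_of_eval_rep hg fun r hr => ?_
    by_cases hrp : r = p
    · rw [hrp]
      exact hgp (by omega)
    · exact hgr r hr hrp
  obtain ⟨v, hv⟩ := F.range_aug.ge hgI
  -- If all generators had degree at most `e`, all of `I` would vanish at `q`, contradicting `g`.
  have h0 : ∀ b, eval q.rep (F.aug (Pi.single b 1)) = 0 := by
    intro b
    rcases F.aug_homogeneous b with h | ⟨k, hk, h⟩
    · rw [h, map_zero]
    · have := hb b
      exact eval_rep_eq_zero_of_isHomogeneous_of_le hN h (by omega) (F.range_aug.le ⟨_, rfl⟩)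
  rw [← hv, pi_eq_sum_univ' v, map_sum, map_sum] at hgq
  simp [h0] at hgq

end Regularity

theorem lemma3p1 {K : Type*} [Field K] [Fintype K] (N : ℕ) (hN : 1 ≤ N)
    (q : Projectivization K (Fin (N + 1) → K)) :
    HasRegularity (pointsIdeal ({q}ᶜ : Set (Projectivization K (Fin (N + 1) → K))))
      ((N : ℤ) * ((Fintype.card K : ℤ) - 1) + 1) := by
  constructor
  · obtain ⟨F⟩ := nonempty_minimalGradedFreeResolution
      (pointsIdeal ({q}ᶜ : Set (Projectivization K (Fin (N + 1) → K))))
      fun _ hf e => twistComponent_mem_pointsIdeal hf e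
    obtain ⟨b, hb⟩ := exists_le_shift_zero hN F
    refine ⟨F, 0, b, le_antisymm ?_ (shift_sub_le hN F 0 b)⟩
    simpa using hb
  · rintro _ ⟨F, i, b, rfl⟩
    exact shift_sub_le hN F i b
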